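/- For $0<\alpha<\pi/4$ and bits $p,i,j\in\{0,1\}$ let $$|\Psi_{p,i,j}(\alpha)\rangle=(\cos\alpha)^{1-p}(\sin\alpha)^{p}\,|0\,i\,j\rangle+(-1)^p(\cos\alpha)^{p}(\sin\alpha)^{1-p}\,|1\,\bar i\,\bar j\rangle ,\qquad \bar i=1-i,\ \bar j=1-j,$$ and call a vector of $(\mathbb C^2)^{\otimes 3}$ a three-qubit CAT state with parameter $\alpha$ if it equals one of these eight vectors up to a global phase. Theorem 1. Let $0<\alpha<\pi/4$, let $S$ be a set of at least two pairwise orthogonal three-qubit CAT states with parameter $\alpha$, and let $|b\rangle$ be a three-qubit CAT state with the same parameter $\alpha$. Then the states of $S$ cannot be exactly cloned by LOCC with blank copy $|b\rangle$: with three parties, each of which holds one qubit of the unknown state and the corresponding qubit of the blank copy, there is no LOCC operation $\Lambda$ with $$\Lambda\bigl(P[\psi\otimes b]\bigr)=P[\psi\otimes\psi]\qquad\text{for all }\psi\in S,$$ where $P[v]=|v\rangle\langle v|$. Here an LOCC operation is one implemented by a protocol with finitely many rounds of local generalized measurements, with finitely many outcomes that are announced to all parties and on which later local measurements may depend, or a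 limit of such operations (so that protocols with infinitely many rounds are covered). -/

import Mathlib

open Filter Topology
open scoped Matrix

noncomputable section

namespace CatCloning

/-- Three qubits, one per party; `Fin 3 → Fin 2` labels the computational basis `|x₀ x₁ x₂⟩`. -/
abbrev ThreeQubit : Type := EuclideanSpace ℂ (Fin 3 → Fin 2)

/-- Each of the three parties holds two qubits: `(x k).1` labels the qubit of party `k` that belongs
to the first three-qubit register, `(x k).2` the one that belongs to the second register. -/
abbrev TwoRegisters : Type := EuclideanSpace ℂ (Fin 3 → Fin 2 × Fin 2)

/-- The computational basis vector `|a b c⟩`. -/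
def ket (a b c : Fin 2) : ThreeQubit := EuclideanSpace.single ![a, b, c] 1

/-- The canonical three-qubit CAT state
`(cos α)^(1-p) (sin α)^p |0 i j⟩ + (-1)^p (cos α)^p (sin α)^(1-p) |1 i̅ j̅⟩`, for bits `p, i, j`.
The negation of a bit `i : Fin 2` is `1 - i`. -/
def catState (α : ℝ) (p i j : Fin 2) : ThreeQubit :=
  ((Real.cos α ^ (1 - (p : ℕ)) * Real.sin α ^ (p : ℕ) : ℝ) : ℂ) • ket 0 i j
    + (((-1) ^ (p : ℕ) * Real.cos α ^ (p : ℕ) * Real.sin α ^ (1 - (p : ℕ)) : ℝ) : ℂ) •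
        ket 1 (1 - i) (1 - j)

/-- `ψ` is, up to a global phase, one of the eight canonical CAT states with parameter `α`. -/
def IsCAT (α : ℝ) (ψ : ThreeQubit) : Prop :=
  ∃ (z : ℂ) (p i j : Fin 2), ‖z‖ = 1 ∧ ψ = z • catState α p i j

/-- The state `ψ ⊗ φ` with `ψ` in the first and `φ` in the second register, seen as a state of the
three parties. -/
def tensor (ψ φ : ThreeQubit) : TwoRegisters :=
  WithLp.toLp 2 fun x => ψ (fun k => (x k).1) * φ (fun k => (x k).2)

/-- The rank-one operator `|v⟩⟨v|`, the density matrix of the pure state `v`. -/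
def proj {ι : Type} (v : EuclideanSpace ℂ ι) : Matrix ι ι ℂ :=
  Matrix.vecMulVec v.ofLp (star v.ofLp)

/-- The tensor product `A 0 ⊗ A 1 ⊗ A 2` of local operators, where `H k` and `K k` index bases of
the local spaces of party `k` before and after. -/
def tensorOp {H K : Fin 3 → Type} (A : ∀ k, Matrix (K k) (H k) ℂ) :
    Matrix (∀ k, K k) (∀ k, H k) ℂ :=
  Matrix.of fun y x => ∏ k, A k (y k) (x k)

/-- The operations of three-party LOCC protocols with finitely many rounds, from systems with local
bases `H` to systems with local bases `K`. Either the protocol stops, or there is a round: every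
party `k` performs a generalized measurement with Kraus operators `A k r`, `r : Fin (n k)`, on its
own system (the local spaces `M k` after the measurement may be different ones, so local ancillas
can be appended or discarded), announces its outcome, and the parties go on with a protocol `Λ m`
that depends on the list `m` of all the outcomes. A party that does nothing in a round has the
identity as its only Kraus operator. -/
inductive FiniteRoundLOCC (K : Fin 3 → Type) [∀ k, Fintype (K k)] [∀ k, DecidableEq (K k)] :
    (H : Fin 3 → Type) → [∀ k, Fintype (H k)] → [∀ k, DecidableEq (H k)] →
    (Matrix (∀ k, H k) (∀ k, H k) ℂ → Matrix (∀ k, K k) (∀ k, K k) ℂ) → Prop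
  | finish : FiniteRoundLOCC K K (fun ρ => ρ)
  | round (H M : Fin 3 → Type) [∀ k, Fintype (H k)] [∀ k, DecidableEq (H k)]
      [∀ k, Fintype (M k)] [∀ k, DecidableEq (M k)]
      (n : Fin 3 → ℕ) (A : ∀ k, Fin (n k) → Matrix (M k) (H k) ℂ)
      (hA : ∀ k, ∑ r, (A k r)ᴴ * A k r = 1)
      (Λ : (∀ k, Fin (n k)) →
        Matrix (∀ k, M k) (∀ k, M k) ℂ → Matrix (∀ k, K k) (∀ k, K k) ℂ)
      (hΛ : ∀ m, FiniteRoundLOCC K M (Λ m)) :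
      FiniteRoundLOCC K H (fun ρ =>
        ∑ m : (∀ k, Fin (n k)),
          Λ m (tensorOp (fun k => A k (m k)) * ρ * (tensorOp (fun k => A k (m k)))ᴴ))

/-- LOCC operations in the widest usual sense: limits of finite-round ones. A finite-round operation
is one (constant sequence), and so is what a protocol with infinitely many rounds or infinitely many
measurement outcomes does. -/
def IsLOCC {H K : Fin 3 → Type} [∀ k, Fintype (H k)] [∀ k, DecidableEq (H k)]
    [∀ k, Fintype (K k)] [∀ k, DecidableEq (K k)]
    (Λ : Matrix (∀ k, H k) (∀ k, H k) ℂ → Matrix (∀ k, K k) (∀ k, K k) ℂ) : Prop :=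
  ∃ Φ : ℕ → Matrix (∀ k, H k) (∀ k, H k) ℂ → Matrix (∀ k, K k) (∀ k, K k) ℂ,
    (∀ N, FiniteRoundLOCC K H (Φ N)) ∧ ∀ ρ, Tendsto (fun N => Φ N ρ) atTop (𝓝 (Λ ρ))

/-- The states of `S` can be exactly cloned by LOCC with blank copy `b`: one LOCC operation, with the
three parties acting separately, takes `ψ ⊗ b` to `ψ ⊗ ψ` for all `ψ ∈ S`. -/
def LOCCClonable (S : Set ThreeQubit) (b : ThreeQubit) : Prop :=
  ∃ Λ : Matrix (Fin 3 → Fin 2 × Fin 2) (Fin 3 → Fin 2 × Fin 2) ℂ →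
      Matrix (Fin 3 → Fin 2 × Fin 2) (Fin 3 → Fin 2 × Fin 2) ℂ,
    IsLOCC (H := fun _ => Fin 2 × Fin 2) (K := fun _ => Fin 2 × Fin 2) Λ ∧
      ∀ ψ ∈ S, Λ (proj (tensor ψ b)) = proj (tensor ψ ψ)

end CatCloning

end

/-!
Cloning is impossible because it would have to be done by local unitaries, and local unitaries
preserve overlaps of reduced states.

*From LOCC to one product operator.* A finite-round operation has Kraus operators of product form
(`FiniteRoundLOCC.exists_kraus`). Cut off one party `k₀` from the two others. Every CAT state is a
sum of two opposite basis vectors, so with suitable bits for the two other parties it is a two-qubit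
state across the cut, with a `2 × 2` amplitude matrix; `k₀` can be chosen such that one choice of
bits serves both states of `S` under consideration (`exists_cutLabel_eq`). For two registers, a product
Kraus operator acts on `4 × 4` amplitude matrices as `M ↦ A * M * Bᵀ`, and the completeness relation
gives `∑ frobSq A * frobSq B ≤ 4 ^ 2`. The clonings by finite-round operations are only approximate,
but a compactness argument yields a single pair `A`, `B` with `frobSq A = frobSq B = 4` which takes
the inputs exactly to multiples of the clones and does not shorten the first of them
(`exists_product_operator`).

*This operator is unitary.* Since `ψ`, `b` have the same nonzero Schmidt coefficients across the cut,
the amplitude matrices of `ψ ⊗ b` and `ψ ⊗ ψ` have determinants of the same nonzero modulus. So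
`1 ≤ ‖det A‖ * ‖det B‖`, whereas the inequality of the arithmetic and geometric means gives
`‖det A‖ ≤ 1` and `‖det B‖ ≤ 1`, with equality only for unitary matrices
(`norm_det_le_one_of_frobSq_eq`, `isometry_of_clones`).

*Unitaries do not clone.* On each side of the cut, the reduced states of `ψ`, `φ`, `b` are diagonal
with entries `cos² α`, `sin² α` in some order. If those of `ψ` and `φ` on one side differ, their
overlap is `t = 2 cos² α sin² α`, and cloning by local unitaries would give
`t * (cos⁴ α + sin⁴ α) = t ^ 2`, which forces `cos² α = sin² α` (`snd_eq_of_isometry_clones`).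
So `ψ` and `φ` have the same reduced states on both sides. Then they have their larger amplitude on
the same basis vector (`dominant_eq_of_isLOCC`), which makes them equal up to a phase and not orthogonal.
-/

namespace CatCloning

/-! ### Kraus representation of finite-round protocols -/

section Kraus

variable {H M K : Fin 3 → Type}

theorem tensorOp_mul [∀ k, Fintype (M k)] (B : ∀ k, Matrix (K k) (M k) ℂ)
    (A : ∀ k, Matrix (M k) (H k) ℂ) :
    tensorOp (fun k => B k * A k) = tensorOp B * tensorOp A := by
  ext y x
  simp only [tensorOp, Matrix.of_apply, Matrix.mul_apply, ← Finset.prod_mul_distrib]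
  rw [Finset.prod_univ_sum, Fintype.piFinset_univ]

theorem tensorOp_conjTranspose (A : ∀ k, Matrix (K k) (H k) ℂ) :
    (tensorOp A)ᴴ = tensorOp (fun k => (A k)ᴴ) := by
  ext y x
  simp [tensorOp, Matrix.conjTranspose_apply]

theorem tensorOp_one [∀ k, DecidableEq (H k)] :
    tensorOp (fun k => (1 : Matrix (H k) (H k) ℂ)) = 1 := by
  ext y x
  simp [tensorOp, Matrix.one_apply, funext_iff, Finset.prod_ite_zero]

theorem sum_tensorOp {n : Fin 3 → ℕ} (A : ∀ k, Fin (n k) → Matrix (K k) (H k) ℂ) :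
    ∑ m : (∀ k, Fin (n k)), tensorOp (fun k => A k (m k)) = tensorOp (fun k => ∑ r, A k r) := by
  ext y x
  simp only [tensorOp, Matrix.of_apply, Matrix.sum_apply]
  rw [Finset.prod_univ_sum, Fintype.piFinset_univ]

/-- Composing the local measurements along each branch of the protocol shows that a finite-round
operation is separable: it has finitely many Kraus operators, all of product form. -/
theorem FiniteRoundLOCC.exists_kraus [∀ k, Fintype (K k)] [∀ k, DecidableEq (K k)]
    [∀ k, Fintype (H k)] [∀ k, DecidableEq (H k)]
    {Λ : Matrix (∀ k, H k) (∀ k, H k) ℂ → Matrix (∀ k, K k) (∀ k, K k) ℂ}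
    (h : FiniteRoundLOCC K H Λ) :
    ∃ (ι : Type) (_ : Fintype ι) (A : ι → ∀ k, Matrix (K k) (H k) ℂ),
      (∀ ρ, Λ ρ = ∑ i, tensorOp (A i) * ρ * (tensorOp (A i))ᴴ) ∧
        ∑ i, (tensorOp (A i))ᴴ * tensorOp (A i) = 1 := by
  induction h with
  | finish => exact ⟨Unit, inferInstance, fun _ k => 1, by simp [tensorOp_one], by
      simp [tensorOp_one]⟩
  | round H M n A hA Λ hΛ ih =>
    choose ι hι B hB hB1 using ih
    refine ⟨Σ m, ι m, inferInstance, fun mi k => B mi.1 mi.2 k * A k (mi.1 k), ?_, ?_⟩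
    · intro ρ
      rw [Fintype.sum_sigma]
      refine Finset.sum_congr rfl fun m _ => ?_
      rw [hB]
      refine Finset.sum_congr rfl fun i _ => ?_
      simp only [tensorOp_mul, Matrix.conjTranspose_mul, Matrix.mul_assoc]
    · rw [Fintype.sum_sigma]
      have key : ∀ m : (∀ k, Fin (n k)),
          ∑ i, (tensorOp (fun k => B m i k * A k (m k)))ᴴ *
              tensorOp (fun k => B m i k * A k (m k)) =
            tensorOp (fun k => (A k (m k))ᴴ * A k (m k)) := by
        intro m
        have : ∀ i, (tensorOp (fun k => B m i k * A k (m k)))ᴴ *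
              tensorOp (fun k => B m i k * A k (m k)) =
            (tensorOp fun k => A k (m k))ᴴ * ((tensorOp (B m i))ᴴ * tensorOp (B m i)) *
              tensorOp (fun k => A k (m k)) := fun i => by
          rw [tensorOp_mul (B m i) fun k => A k (m k)]
          simp only [Matrix.conjTranspose_mul, Matrix.mul_assoc]
        rw [Finset.sum_congr rfl fun i _ => this i, ← Matrix.sum_mul, ← Matrix.mul_sum, hB1,
          Matrix.mul_one, tensorOp_conjTranspose, ← tensorOp_mul]
      rw [Finset.sum_congr rfl fun m _ => key m, sum_tensorOp fun k r => (A k r)ᴴ * A k r]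
      simp only [hA]
      exact tensorOp_one

end Kraus

/-! ### Matrices that maximise the determinant -/

section Det

variable {n : Type*} [Fintype n]

/-- The squared Frobenius norm. -/
noncomputable def frobSq {m n : Type*} [Fintype m] [Fintype n] (A : Matrix m n ℂ) : ℝ :=
  ∑ i, ∑ j, ‖A i j‖ ^ 2

theorem trace_conjTranspose_mul_self {m : Type*} [Fintype m] (A : Matrix m n ℂ) :
    (Aᴴ * A).trace = (frobSq A : ℂ) := by
  simp only [Matrix.trace, Matrix.diag_apply, Matrix.mul_apply, Matrix.conjTranspose_apply, frobSq,
    Complex.ofReal_sum, Complex.ofReal_pow]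
  rw [Finset.sum_comm]
  refine Finset.sum_congr rfl fun i _ => Finset.sum_congr rfl fun j _ => ?_
  exact Complex.conj_mul' _

open scoped ComplexOrder in
/-- The arithmetic-geometric mean inequality for the eigenvalues of `Aᴴ * A`, with its equality
case. -/
theorem norm_det_le_one_of_frobSq_eq [DecidableEq n] (A : Matrix n n ℂ)
    (hA : frobSq A = Fintype.card n) : ‖A.det‖ ≤ 1 ∧ (1 ≤ ‖A.det‖ → Aᴴ * A = 1) := by
  have hP : (Aᴴ * A).PosSemidef := Matrix.posSemidef_conjTranspose_mul_self A
  set μ := hP.isHermitian.eigenvalues with hμ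
  have hμ0 : ∀ i, 0 ≤ μ i := hP.eigenvalues_nonneg
  have hsum : ∑ i, μ i = Fintype.card n := by
    have := hP.isHermitian.trace_eq_sum_eigenvalues
    rw [trace_conjTranspose_mul_self, hA] at this
    apply Complex.ofReal_injective
    rw [this, Complex.ofReal_sum]
    rfl
  have hprod : ∏ i, μ i = ‖A.det‖ ^ 2 := by
    have := hP.isHermitian.det_eq_prod_eigenvalues
    rw [Matrix.det_mul, Matrix.det_conjTranspose, Complex.star_def, Complex.conj_mul'] at this
    apply Complex.ofReal_injective
    rw [Complex.ofReal_pow, this, Complex.ofReal_prod]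
    rfl
  rcases eq_or_ne A.det 0 with h0 | h0
  · simp [h0]
  have hpos : ∀ i, 0 < μ i := by
    intro i
    refine (hμ0 i).lt_of_ne' fun hi => h0 ?_
    have : ∏ i, μ i = 0 := Finset.prod_eq_zero (Finset.mem_univ i) hi
    rw [hprod] at this
    simpa using this
  have hlog : ∑ i, (μ i - 1 - Real.log (μ i)) = - Real.log (‖A.det‖ ^ 2) := by
    rw [← hprod, Real.log_prod fun i _ => (hpos i).ne']
    simp [Finset.sum_sub_distrib, hsum]
  have hterm : ∀ i, 0 ≤ μ i - 1 - Real.log (μ i) := fun i => by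
    linarith [Real.log_le_sub_one_of_pos (hpos i)]
  have hdet : 0 < ‖A.det‖ := norm_pos_iff.2 h0
  constructor
  · have h1 : 0 ≤ - Real.log (‖A.det‖ ^ 2) := hlog ▸ Finset.sum_nonneg fun i _ => hterm i
    have h2 : ‖A.det‖ ^ 2 ≤ 1 := by
      by_contra! h
      linarith [Real.log_pos h]
    exact (pow_le_one_iff_of_nonneg hdet.le two_ne_zero).1 h2
  · intro h1
    have h2 : 0 ≤ Real.log (‖A.det‖ ^ 2) := Real.log_nonneg (one_le_pow₀ h1)
    have h3 : ∑ i, (μ i - 1 - Real.log (μ i)) = 0 :=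
      le_antisymm (by rw [hlog]; linarith) (Finset.sum_nonneg fun i _ => hterm i)
    have h4 : ∀ i, μ i = 1 := by
      intro i
      have h5 := (Finset.sum_eq_zero_iff_of_nonneg fun i _ => hterm i).1 h3 i (Finset.mem_univ i)
      by_contra hne
      linarith [Real.log_lt_sub_one_of_pos (hpos i) hne]
    rw [hP.isHermitian.spectral_theorem]
    have : (RCLike.ofReal ∘ hP.isHermitian.eigenvalues : n → ℂ) = fun _ => 1 := by
      funext i
      simp [← hμ, h4 i]
    rw [this, Matrix.diagonal_one, map_one]

end Det

/-! ### Passing to a limit of product Kraus operators -/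

section Limit

variable {n : Type} [Fintype n]

/-- The sum of the squared absolute values of the `2 × 2` minors formed from the entries of `N` and
`C`; it vanishes when `C` is a multiple of `N`, and only then if `N ≠ 0`. -/
noncomputable def defect (N C : Matrix n n ℂ) : ℝ :=
  ∑ a : n × n, ∑ b : n × n, ‖N b.1 b.2 * C a.1 a.2 - N a.1 a.2 * C b.1 b.2‖ ^ 2

theorem defect_nonneg (N C : Matrix n n ℂ) : 0 ≤ defect N C := by
  unfold defect; positivity

theorem frobSq_nonneg {m : Type*} [Fintype m] (A : Matrix m n ℂ) : 0 ≤ frobSq A := by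
  unfold frobSq; positivity

theorem frobSq_smul (z : ℂ) (A : Matrix n n ℂ) : frobSq (z • A) = ‖z‖ ^ 2 * frobSq A := by
  simp [frobSq, mul_pow, Finset.mul_sum]

theorem defect_smul (z : ℂ) (N C : Matrix n n ℂ) : defect N (z • C) = ‖z‖ ^ 2 * defect N C := by
  simp only [defect, Finset.mul_sum]
  refine Finset.sum_congr rfl fun a _ => Finset.sum_congr rfl fun b _ => ?_
  rw [← mul_pow, ← norm_mul]
  simp only [Matrix.smul_apply, smul_eq_mul]
  ring_nf

theorem eq_zero_of_frobSq_eq_zero {A : Matrix n n ℂ} (h : frobSq A = 0) : A = 0 := by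
  ext i j
  have h1 := (Finset.sum_eq_zero_iff_of_nonneg fun i _ => by positivity).1 h i (Finset.mem_univ i)
  have h2 := (Finset.sum_eq_zero_iff_of_nonneg fun j _ => by positivity).1 h1 j (Finset.mem_univ j)
  simpa using h2

theorem exists_smul_of_defect_eq_zero {N C : Matrix n n ℂ} (hN : N ≠ 0) (h : defect N C = 0) :
    ∃ z : ℂ, C = z • N := by
  obtain ⟨i, j, hij⟩ : ∃ i j, N i j ≠ 0 := by
    by_contra! hc
    exact hN (by ext i j; simp [hc])
  refine ⟨C i j / N i j, ?_⟩
  ext k l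
  have h1 := (Finset.sum_eq_zero_iff_of_nonneg fun i _ => by positivity).1 h (k, l)
    (Finset.mem_univ _)
  have h2 := (Finset.sum_eq_zero_iff_of_nonneg fun j _ => by positivity).1 h1 (i, j)
    (Finset.mem_univ _)
  have h3 : N i j * C k l - N k l * C i j = 0 := by simpa using h2
  rw [Matrix.smul_apply, smul_eq_mul]
  field_simp
  linear_combination h3

theorem continuous_frobSq : Continuous (frobSq : Matrix n n ℂ → ℝ) := by
  unfold frobSq; fun_prop

theorem continuous_defect (N : Matrix n n ℂ) : Continuous (defect N) := by
  unfold defect; fun_prop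

theorem isCompact_frobSq_eq (r : ℝ) : IsCompact {A : Matrix n n ℂ | frobSq A = r} := by
  have hbox : IsCompact (Set.univ.pi fun _ => Set.univ.pi fun _ =>
      Metric.closedBall (0 : ℂ) (Real.sqrt r) : Set (n → n → ℂ)) :=
    isCompact_univ_pi fun _ => isCompact_univ_pi fun _ => isCompact_closedBall _ _
  refine hbox.of_isClosed_subset (isClosed_eq continuous_frobSq continuous_const) ?_
  intro A hA i _ j _
  rw [mem_closedBall_zero_iff]
  refine Real.le_sqrt_of_sq_le ?_
  rw [← (hA : frobSq A = r)]
  refine le_trans ?_ (Finset.single_le_sum (f := fun i => ∑ j, ‖A i j‖ ^ 2)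
    (fun i _ => by positivity) (Finset.mem_univ i))
  exact Finset.single_le_sum (f := fun j => ‖A i j‖ ^ 2) (fun j _ => by positivity)
    (Finset.mem_univ j)

/-- If families of product Kraus operators `A i ⊗ B i` send `M` arbitrarily well to multiples of `N`
and `M'` to multiples of `N'`, then a single product operator does so exactly, and it may be taken
such that `M` loses no norm relative to the weight `frobSq A * frobSq B / s ^ 2` of the operator.
For a large penalty `k` on the defects, some member of a good enough family has a penalised gain
close to its weight; the normalised operators of this kind form nested nonempty compact sets. -/
theorem exists_product_operator {s : ℝ} (hs : 0 < s) {M N M' N' : Matrix n n ℂ}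
    (h : ∀ δ > 0, ∃ (ι : Type) (_ : Fintype ι) (A B : ι → Matrix n n ℂ),
      ∑ i, frobSq (A i) * frobSq (B i) ≤ s ^ 2 ∧
      1 - δ ≤ ∑ i, frobSq (A i * M * (B i)ᵀ) ∧
      ∑ i, (defect N (A i * M * (B i)ᵀ) + defect N' (A i * M' * (B i)ᵀ)) ≤ δ) :
    ∃ A B : Matrix n n ℂ, frobSq A = s ∧ frobSq B = s ∧ 1 ≤ frobSq (A * M * Bᵀ) ∧
      defect N (A * M * Bᵀ) = 0 ∧ defect N' (A * M' * Bᵀ) = 0 := by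
  let gain : Matrix n n ℂ × Matrix n n ℂ → ℝ := fun P => frobSq (P.1 * M * P.2ᵀ)
  let err : Matrix n n ℂ × Matrix n n ℂ → ℝ := fun P =>
    defect N (P.1 * M * P.2ᵀ) + defect N' (P.1 * M' * P.2ᵀ)
  have hgc : Continuous gain := continuous_frobSq.comp (by fun_prop)
  have hec : Continuous err := ((continuous_defect N).comp (by fun_prop)).add
    ((continuous_defect N').comp (by fun_prop))
  have herr : ∀ P, 0 ≤ err P := fun P => add_nonneg (defect_nonneg _ _) (defect_nonneg _ _)
  let F : ℕ → Set (Matrix n n ℂ × Matrix n n ℂ) := fun k =>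
    ({A | frobSq A = s} ×ˢ {B | frobSq B = s}) ∩
      {P | 1 - 1 / ((k : ℝ) + 1) ≤ gain P - k * err P}
  have hclosed : ∀ k, IsClosed {P | 1 - 1 / ((k : ℝ) + 1) ≤ gain P - k * err P} := fun k =>
    isClosed_le continuous_const (by fun_prop)
  have hcomp : ∀ k, IsCompact (F k) := fun k =>
    ((isCompact_frobSq_eq s).prod (isCompact_frobSq_eq s)).inter_right (hclosed k)
  have hne : ∀ k, (F k).Nonempty := by
    intro k
    have hk : (0 : ℝ) ≤ k := k.cast_nonneg
    -- This choice makes the total penalised deficit `(k + 1) * δ` smaller than `1 / (k + 1)`.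
    obtain ⟨ι, _, A, B, hw, hg, he⟩ := h (1 / (((k : ℝ) + 1) * (k + 2))) (by positivity)
    obtain ⟨i, hi⟩ : ∃ i, (1 - 1 / ((k : ℝ) + 1)) * (frobSq (A i) * frobSq (B i) / s ^ 2) <
        gain (A i, B i) - k * err (A i, B i) := by
      by_contra! hc
      have h1 := Finset.sum_le_sum fun i (_ : i ∈ Finset.univ) => hc i
      rw [← Finset.mul_sum, ← Finset.sum_div, Finset.sum_sub_distrib, ← Finset.mul_sum] at h1
      have h2 : (∑ i, frobSq (A i) * frobSq (B i)) / s ^ 2 ≤ 1 :=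
        (div_le_one (by positivity)).2 hw
      have h3 : (0 : ℝ) ≤ 1 - 1 / ((k : ℝ) + 1) := by
        rw [sub_nonneg, div_le_one (by positivity)]; linarith
      have h4 := mul_le_mul_of_nonneg_left h2 h3
      have h5 := mul_le_mul_of_nonneg_left he hk
      have h6 : ((k : ℝ) + 1) * (1 / (((k : ℝ) + 1) * (k + 2))) < 1 / ((k : ℝ) + 1) := by
        rw [mul_one_div, div_lt_div_iff₀ (by positivity) (by positivity)]
        nlinarith
      change ∑ i, frobSq (A i * M * (B i)ᵀ) - k * ∑ i, (defect N (A i * M * (B i)ᵀ) +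
        defect N' (A i * M' * (B i)ᵀ)) ≤ _ at h1
      linarith
    have hA : 0 < frobSq (A i) := by
      refine (frobSq_nonneg _).lt_of_ne' fun h0 => ?_
      simp [gain, err, eq_zero_of_frobSq_eq_zero h0, frobSq, defect] at hi
    have hB : 0 < frobSq (B i) := by
      refine (frobSq_nonneg _).lt_of_ne' fun h0 => ?_
      simp [gain, err, eq_zero_of_frobSq_eq_zero h0, frobSq, defect] at hi
    set a : ℝ := Real.sqrt (s / frobSq (A i))
    set b : ℝ := Real.sqrt (s / frobSq (B i))
    have ha2 : a ^ 2 = s / frobSq (A i) := Real.sq_sqrt (by positivity)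
    have hb2 : b ^ 2 = s / frobSq (B i) := Real.sq_sqrt (by positivity)
    have hab : ‖(a : ℂ) * b‖ ^ 2 = a ^ 2 * b ^ 2 := by
      rw [norm_mul, mul_pow]; simp
    have hmul : ∀ X : Matrix n n ℂ, (a : ℂ) • A i * X * ((b : ℂ) • B i)ᵀ =
        ((a : ℂ) * b) • (A i * X * (B i)ᵀ) := fun X => by
      rw [Matrix.transpose_smul, Matrix.smul_mul, Matrix.smul_mul, Matrix.mul_smul, smul_smul]
    refine ⟨((a : ℂ) • A i, (b : ℂ) • B i), ⟨?_, ?_⟩, ?_⟩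
    · change frobSq _ = s
      rw [frobSq_smul]; simp [ha2]; field_simp
    · change frobSq _ = s
      rw [frobSq_smul]; simp [hb2]; field_simp
    · simp only [Set.mem_ofPred_eq, gain, err, hmul, frobSq_smul, defect_smul, hab]
      have hpos : 0 < a ^ 2 * b ^ 2 := by rw [ha2, hb2]; positivity
      have := mul_le_mul_of_nonneg_left hi.le hpos.le
      have h7 : a ^ 2 * b ^ 2 * ((1 - 1 / ((k : ℝ) + 1)) *
          (frobSq (A i) * frobSq (B i) / s ^ 2)) = 1 - 1 / ((k : ℝ) + 1) := by
        rw [ha2, hb2]; field_simp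
      rw [h7] at this
      refine this.trans (le_of_eq ?_)
      simp only [gain, err]; ring
  have hanti : ∀ k, F (k + 1) ⊆ F k := by
    rintro k P ⟨hP, hP'⟩
    refine ⟨hP, ?_⟩
    simp only [Set.mem_ofPred_eq, Nat.cast_add, Nat.cast_one] at hP' ⊢
    have h1 : 1 / ((k : ℝ) + 1 + 1) ≤ 1 / ((k : ℝ) + 1) :=
      one_div_le_one_div_of_le (by positivity) (by linarith)
    nlinarith [herr P]
  obtain ⟨P, hP⟩ := IsCompact.nonempty_iInter_of_sequence_nonempty_isCompact_isClosed F hanti hne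
    (hcomp 0) fun k => (hcomp k).isClosed
  rw [Set.mem_iInter] at hP
  have hk : ∀ k : ℕ, 1 - 1 / ((k : ℝ) + 1) + k * err P ≤ gain P := fun k => by
    have := (hP k).2
    simp only [Set.mem_ofPred_eq] at this
    linarith
  have hgain : 1 ≤ gain P := by
    have hlim : Tendsto (fun k : ℕ => 1 - 1 / ((k : ℝ) + 1)) atTop (𝓝 (1 - 0)) :=
      tendsto_const_nhds.sub tendsto_one_div_add_atTop_nhds_zero_nat
    rw [sub_zero] at hlim
    refine le_of_tendsto' hlim fun k => ?_
    have := mul_nonneg (k.cast_nonneg : (0 : ℝ) ≤ k) (herr P)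
    linarith [hk k]
  have herr0 : err P = 0 := by
    refine (herr P).antisymm' (not_lt.1 fun hpos => ?_)
    obtain ⟨k, hk'⟩ := exists_nat_gt (gain P / err P)
    rw [div_lt_iff₀ hpos] at hk'
    have h1 : 1 / ((k : ℝ) + 1) ≤ 1 := by
      rw [div_le_one (by positivity)]; linarith [(k.cast_nonneg : (0 : ℝ) ≤ k)]
    linarith [hk k]
  exact ⟨P.1, P.2, (hP 0).1.1, (hP 0).1.2, hgain,
    (add_eq_zero_iff_of_nonneg (defect_nonneg _ _) (defect_nonneg _ _)).1 herr0⟩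

end Limit

/-! ### Bipartite states of Schmidt rank two -/

section Bipartite

open scoped Kronecker

/-- The amplitude matrix of the two-qubit state `z |x y⟩ + w |x̅ y̅⟩`. Addition in
`Fin 2` is modulo `2`, so `x + 1` is the negation of the bit `x`. -/
def twoTerm (x y : Fin 2) (z w : ℂ) : Matrix (Fin 2) (Fin 2) ℂ :=
  Matrix.of fun i j => if i = x ∧ j = y then z else if i = x + 1 ∧ j = y + 1 then w else 0

variable {x y x' y' : Fin 2} {z w z' w' : ℂ} {c s : ℝ}

theorem twoTerm_transpose : (twoTerm x y z w)ᵀ = twoTerm y x z w := by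
  ext i j
  simp [twoTerm, and_comm]

theorem norm_det_twoTerm (hz : ‖z‖ = c) (hw : ‖w‖ = s) : ‖(twoTerm x y z w).det‖ = c * s := by
  subst hz hw
  fin_cases x <;> fin_cases y <;> simp [twoTerm, Matrix.det_fin_two, mul_comm]

theorem frobSq_twoTerm (hz : ‖z‖ = c) (hw : ‖w‖ = s) :
    frobSq (twoTerm x y z w) = c ^ 2 + s ^ 2 := by
  subst hz hw
  fin_cases x <;> fin_cases y <;> simp [twoTerm, frobSq, add_comm]

theorem twoTerm_gram (hz : ‖z‖ = c) (hw : ‖w‖ = s) :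
    (twoTerm x y z w)ᴴ * twoTerm x y z w =
      Matrix.diagonal fun j => if j = y then (c : ℂ) ^ 2 else (s : ℂ) ^ 2 := by
  subst hz hw
  ext i j
  fin_cases x <;> fin_cases y <;> fin_cases i <;> fin_cases j <;>
    simp [twoTerm, Matrix.mul_apply, Matrix.conjTranspose_apply, Complex.conj_mul']

/-- The overlap of the reduced states of two two-term states on the second qubit. -/
theorem trace_twoTerm_gram_mul (hz : ‖z‖ = c) (hw : ‖w‖ = s) (hz' : ‖z'‖ = c) (hw' : ‖w'‖ = s) :
    (((twoTerm x y z w)ᴴ * twoTerm x y z w) * ((twoTerm x' y' z' w')ᴴ * twoTerm x' y' z' w')).trace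
      = if y = y' then (c : ℂ) ^ 4 + (s : ℂ) ^ 4 else 2 * (c : ℂ) ^ 2 * (s : ℂ) ^ 2 := by
  rw [twoTerm_gram hz hw, twoTerm_gram hz' hw', Matrix.diagonal_mul_diagonal,
    Matrix.trace_diagonal]
  fin_cases y <;> fin_cases y' <;> simp <;> ring

theorem frobSq_kronecker {m n p q : Type*} [Fintype m] [Fintype n] [Fintype p] [Fintype q]
    (A : Matrix m n ℂ) (B : Matrix p q ℂ) : frobSq (A ⊗ₖ B) = frobSq A * frobSq B := by
  apply Complex.ofReal_injective
  rw [← trace_conjTranspose_mul_self, Matrix.conjTranspose_kronecker, ← Matrix.mul_kronecker_mul,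
    Matrix.trace_kronecker, trace_conjTranspose_mul_self, trace_conjTranspose_mul_self,
    Complex.ofReal_mul]

theorem trace_kronecker_gram_mul {m n p q : Type*} [Fintype m] [Fintype n] [Fintype p] [Fintype q]
    (A A' : Matrix m n ℂ) (B B' : Matrix p q ℂ) :
    (((A ⊗ₖ B)ᴴ * (A ⊗ₖ B)) * ((A' ⊗ₖ B')ᴴ * (A' ⊗ₖ B'))).trace =
      ((Aᴴ * A) * (A'ᴴ * A')).trace * ((Bᴴ * B) * (B'ᴴ * B')).trace := by
  simp only [Matrix.conjTranspose_kronecker, ← Matrix.mul_kronecker_mul, Matrix.trace_kronecker]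

section Unitary

variable {n : Type*} [Fintype n] [DecidableEq n] {A B : Matrix n n ℂ}

theorem gram_of_isometry (hA : Aᴴ * A = 1) (M : Matrix n n ℂ) :
    (A * M * Bᵀ)ᴴ * (A * M * Bᵀ) = (Bᵀ)ᴴ * (Mᴴ * M) * Bᵀ := by
  calc (A * M * Bᵀ)ᴴ * (A * M * Bᵀ) = (Bᵀ)ᴴ * Mᴴ * (Aᴴ * A) * M * Bᵀ := by
        simp only [Matrix.conjTranspose_mul, Matrix.mul_assoc]
    _ = _ := by rw [hA, Matrix.mul_one]; simp only [Matrix.mul_assoc]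

theorem transpose_mul_conjTranspose_transpose (hB : Bᴴ * B = 1) : Bᵀ * (Bᵀ)ᴴ = 1 := by
  have := congrArg Matrix.transpose hB
  rwa [Matrix.transpose_mul, Matrix.transpose_one] at this

theorem frobSq_of_isometry (hA : Aᴴ * A = 1) (hB : Bᴴ * B = 1) (M : Matrix n n ℂ) :
    frobSq (A * M * Bᵀ) = frobSq M := by
  apply Complex.ofReal_injective
  rw [← trace_conjTranspose_mul_self, gram_of_isometry hA, Matrix.trace_mul_comm,
    ← Matrix.mul_assoc, transpose_mul_conjTranspose_transpose hB, Matrix.one_mul,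
    trace_conjTranspose_mul_self]

/-- Local unitaries preserve the overlap of the reduced states of two bipartite states. -/
theorem trace_gram_mul_of_isometry (hA : Aᴴ * A = 1) (hB : Bᴴ * B = 1) (M M' : Matrix n n ℂ) :
    (((A * M * Bᵀ)ᴴ * (A * M * Bᵀ)) * ((A * M' * Bᵀ)ᴴ * (A * M' * Bᵀ))).trace =
      ((Mᴴ * M) * (M'ᴴ * M')).trace := by
  have h1 := transpose_mul_conjTranspose_transpose hB
  rw [gram_of_isometry hA, gram_of_isometry hA]
  calc ((Bᵀ)ᴴ * (Mᴴ * M) * Bᵀ * ((Bᵀ)ᴴ * (M'ᴴ * M') * Bᵀ)).trace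
      = ((Bᵀ)ᴴ * ((Mᴴ * M) * (Bᵀ * (Bᵀ)ᴴ) * (M'ᴴ * M') * Bᵀ)).trace := by
        simp only [Matrix.mul_assoc]
    _ = ((Mᴴ * M) * (Bᵀ * (Bᵀ)ᴴ) * (M'ᴴ * M') * (Bᵀ * (Bᵀ)ᴴ)).trace := by
        rw [Matrix.trace_mul_comm]; simp only [Matrix.mul_assoc]
    _ = _ := by rw [h1, Matrix.mul_one, Matrix.mul_one]

end Unitary

variable {xb yb : Fin 2} {zb wb lam mu : ℂ} {A B : Matrix (Fin 2 × Fin 2) (Fin 2 × Fin 2) ℂ}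

/-- If local unitaries clone two two-term states, then the states have the same reduced state on the
second qubit: with `t` the overlap of these reduced states, cloning changes the overlap
`t * (c ^ 4 + s ^ 4)` into `t ^ 2`. -/
theorem snd_eq_of_isometry_clones (hs : 0 < s) (hcs : s < c) (h1 : c ^ 2 + s ^ 2 = 1)
    (hz : ‖z‖ = c) (hw : ‖w‖ = s) (hz' : ‖z'‖ = c) (hw' : ‖w'‖ = s) (hzb : ‖zb‖ = c)
    (hwb : ‖wb‖ = s) (hA : Aᴴ * A = 1) (hB : Bᴴ * B = 1)
    (h : A * (twoTerm x y z w ⊗ₖ twoTerm xb yb zb wb) * Bᵀ =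
      lam • (twoTerm x y z w ⊗ₖ twoTerm x y z w))
    (h' : A * (twoTerm x' y' z' w' ⊗ₖ twoTerm xb yb zb wb) * Bᵀ =
      mu • (twoTerm x' y' z' w' ⊗ₖ twoTerm x' y' z' w')) : y = y' := by
  have hlam : ‖lam‖ ^ 2 = 1 := by
    have := frobSq_of_isometry hA hB (twoTerm x y z w ⊗ₖ twoTerm xb yb zb wb)
    rw [h, frobSq_smul, frobSq_kronecker, frobSq_kronecker, frobSq_twoTerm hz hw,
      frobSq_twoTerm hzb hwb, h1] at this
    simpa using this
  have hmu : ‖mu‖ ^ 2 = 1 := by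
    have := frobSq_of_isometry hA hB (twoTerm x' y' z' w' ⊗ₖ twoTerm xb yb zb wb)
    rw [h', frobSq_smul, frobSq_kronecker, frobSq_kronecker, frobSq_twoTerm hz' hw',
      frobSq_twoTerm hzb hwb, h1] at this
    simpa using this
  have hgram : ∀ (k : ℂ) (N : Matrix (Fin 2 × Fin 2) (Fin 2 × Fin 2) ℂ), ‖k‖ ^ 2 = 1 →
      (k • N)ᴴ * (k • N) = Nᴴ * N := fun k N hk => by
    have : star k * k = 1 := by
      rw [Complex.star_def, Complex.conj_mul']; exact_mod_cast hk
    rw [Matrix.conjTranspose_smul, Matrix.smul_mul, Matrix.mul_smul, smul_smul, this, one_smul]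
  have key := trace_gram_mul_of_isometry hA hB (twoTerm x y z w ⊗ₖ twoTerm xb yb zb wb)
    (twoTerm x' y' z' w' ⊗ₖ twoTerm xb yb zb wb)
  rw [h, h', hgram _ _ hlam, hgram _ _ hmu, trace_kronecker_gram_mul, trace_kronecker_gram_mul,
    trace_twoTerm_gram_mul hz hw hz' hw', trace_twoTerm_gram_mul hzb hwb hzb hwb] at key
  by_contra hne
  rw [if_neg hne, if_pos rfl] at key
  have key' : (2 * c ^ 2 * s ^ 2) * (2 * c ^ 2 * s ^ 2) =
      (2 * c ^ 2 * s ^ 2) * (c ^ 4 + s ^ 4) := by exact_mod_cast key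
  have hpos : 0 < 2 * c ^ 2 * s ^ 2 := by have := hs.trans hcs; positivity
  have h2 := mul_left_cancel₀ hpos.ne' key'
  have h3 : (c ^ 2 - s ^ 2) ^ 2 = 0 := by linear_combination -h2
  have h4 : c ^ 2 - s ^ 2 = 0 := by simpa using h3
  nlinarith

/-- A product operator with factors of squared Frobenius norm `4` which takes `Ψ ⊗ β` to `λ Ψ ⊗ Ψ`
with `1 ≤ |λ|`, where `Ψ` and `β` have the same nonzero Schmidt coefficients, is unitary in both
factors, since it does not decrease the determinant of the amplitude matrix. -/
theorem isometry_of_clones (hs : 0 < s) (hcs : s < c) (h1 : c ^ 2 + s ^ 2 = 1)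
    (hz : ‖z‖ = c) (hw : ‖w‖ = s) (hzb : ‖zb‖ = c) (hwb : ‖wb‖ = s)
    (hA : frobSq A = 4) (hB : frobSq B = 4)
    (hgain : 1 ≤ frobSq (A * (twoTerm x y z w ⊗ₖ twoTerm xb yb zb wb) * Bᵀ))
    (h : A * (twoTerm x y z w ⊗ₖ twoTerm xb yb zb wb) * Bᵀ =
      lam • (twoTerm x y z w ⊗ₖ twoTerm x y z w)) : Aᴴ * A = 1 ∧ Bᴴ * B = 1 := by
  rw [h, frobSq_smul, frobSq_kronecker, frobSq_twoTerm hz hw, h1] at hgain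
  have hdet := congrArg (fun X => ‖Matrix.det X‖) h
  simp only [Matrix.det_mul, Matrix.det_transpose, Matrix.det_smul, Matrix.det_kronecker, norm_mul,
    norm_pow, norm_det_twoTerm hz hw, norm_det_twoTerm hzb hwb, Fintype.card_fin,
    Fintype.card_prod] at hdet
  have hpos : 0 < c * s := mul_pos (hs.trans hcs) hs
  have hAB : ‖A.det‖ * ‖B.det‖ = ‖lam‖ ^ 4 := by
    have h2 : (c * s) ^ 2 * (c * s) ^ 2 ≠ 0 := by positivity
    apply mul_left_cancel₀ h2
    linear_combination hdet
  have hlam : 1 ≤ ‖A.det‖ * ‖B.det‖ := by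
    rw [hAB]; nlinarith
  obtain ⟨hA1, hA2⟩ := norm_det_le_one_of_frobSq_eq A (by rw [hA]; norm_num)
  obtain ⟨hB1, hB2⟩ := norm_det_le_one_of_frobSq_eq B (by rw [hB]; norm_num)
  have := norm_nonneg A.det
  have := norm_nonneg B.det
  exact ⟨hA2 (by nlinarith), hB2 (by nlinarith)⟩

/-- No product operator of the kind that `exists_product_operator` provides clones two two-term
states that differ in a reduced state. -/
theorem eq_of_product_operator_clones (hs : 0 < s) (hcs : s < c) (h1 : c ^ 2 + s ^ 2 = 1)
    (hz : ‖z‖ = c) (hw : ‖w‖ = s) (hz' : ‖z'‖ = c) (hw' : ‖w'‖ = s) (hzb : ‖zb‖ = c)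
    (hwb : ‖wb‖ = s) (hA : frobSq A = 4) (hB : frobSq B = 4)
    (hgain : 1 ≤ frobSq (A * (twoTerm x y z w ⊗ₖ twoTerm xb yb zb wb) * Bᵀ))
    (h : A * (twoTerm x y z w ⊗ₖ twoTerm xb yb zb wb) * Bᵀ =
      lam • (twoTerm x y z w ⊗ₖ twoTerm x y z w))
    (h' : A * (twoTerm x' y' z' w' ⊗ₖ twoTerm xb yb zb wb) * Bᵀ =
      mu • (twoTerm x' y' z' w' ⊗ₖ twoTerm x' y' z' w')) : x = x' ∧ y = y' := by
  obtain ⟨hA1, hB1⟩ := isometry_of_clones hs hcs h1 hz hw hzb hwb hA hB hgain h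
  refine ⟨?_, snd_eq_of_isometry_clones hs hcs h1 hz hw hz' hw' hzb hwb hA1 hB1 h h'⟩
  -- Transposing the amplitude matrices exchanges the two sides of the cut.
  have ht := congrArg Matrix.transpose h
  have ht' := congrArg Matrix.transpose h'
  simp only [Matrix.transpose_mul, Matrix.transpose_transpose, Matrix.transpose_smul,
    ← Matrix.kroneckerMap_transpose, twoTerm_transpose, ← Matrix.mul_assoc] at ht ht'
  exact snd_eq_of_isometry_clones hs hcs h1 hz hw hz' hw' hzb hwb hB1 hA1 ht ht'

end Bipartite

/-! ### Cutting off one party -/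

section Cut

open scoped Kronecker

variable {k₀ : Fin 3}

/-- The basis label with bit `x` at party `k₀`, the bits `u` at the other parties being flipped all
together when `y = 1`. For fixed `k₀` and `u` these labels span a two-qubit subspace of the space of
three qubits, the second qubit being shared by the two other parties. -/
def cutLabel (k₀ : Fin 3) (u : Fin 3 → Fin 2) (x y : Fin 2) : Fin 3 → Fin 2 :=
  fun k => if k = k₀ then x else u k + y

theorem cutLabel_self (u : Fin 3 → Fin 2) : cutLabel k₀ u (u k₀) 0 = u := by
  funext k
  by_cases h : k = k₀ <;> simp [cutLabel, h]

theorem cutLabel_add_one (u : Fin 3 → Fin 2) (x y : Fin 2) :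
    cutLabel k₀ u (x + 1) (y + 1) = cutLabel k₀ u x y + 1 := by
  funext k
  by_cases h : k = k₀ <;> simp [cutLabel, h, add_assoc]

theorem cutLabel_inj {u : Fin 3 → Fin 2} {x y x' y' : Fin 2} :
    cutLabel k₀ u x y = cutLabel k₀ u x' y' ↔ x = x' ∧ y = y' := by
  refine ⟨fun h => ⟨by simpa [cutLabel] using congrFun h k₀, ?_⟩, by rintro ⟨rfl, rfl⟩; rfl⟩
  have := congrFun h (k₀ + 1)
  simpa [cutLabel] using this

/-- Two different bit strings of length three agree off one position up to a common flip. -/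
theorem exists_cutLabel_eq (s t : Fin 3 → Fin 2) :
    ∃ k₀ y, t = cutLabel k₀ s (t k₀) y := by
  have : ∀ d : Fin 3 → Fin 2, ∃ k₀ y, ∀ k, k ≠ k₀ → d k = y := by decide
  obtain ⟨k₀, y, h⟩ := this (t - s)
  refine ⟨k₀, y, ?_⟩
  funext k
  by_cases hk : k = k₀
  · simp [cutLabel, hk]
  · simp [cutLabel, hk, ← h k hk]

/-- The labels of the two-register basis vectors spanned by `cutLabel` in both registers: `X` holds
the two bits of party `k₀`, `Y` those of the rest. -/
def pairLabel (k₀ : Fin 3) (u v : Fin 3 → Fin 2) (X Y : Fin 2 × Fin 2) : Fin 3 → Fin 2 × Fin 2 :=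
  fun k => (cutLabel k₀ u X.1 Y.1 k, cutLabel k₀ v X.2 Y.2 k)

theorem pairLabel_injective (u v : Fin 3 → Fin 2) :
    Function.Injective fun p : (Fin 2 × Fin 2) × (Fin 2 × Fin 2) => pairLabel k₀ u v p.1 p.2 := by
  rintro ⟨X, Y⟩ ⟨X', Y'⟩ h
  have h1 : cutLabel k₀ u X.1 Y.1 = cutLabel k₀ u X'.1 Y'.1 :=
    funext fun k => congrArg Prod.fst (congrFun h k)
  have h2 : cutLabel k₀ v X.2 Y.2 = cutLabel k₀ v X'.2 Y'.2 :=
    funext fun k => congrArg Prod.snd (congrFun h k)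
  rw [cutLabel_inj] at h1 h2
  ext <;> simp [h1, h2]

theorem pairLabel_self (u v : Fin 3 → Fin 2) (X Y : Fin 2 × Fin 2) :
    pairLabel k₀ u v X Y k₀ = X := by
  simp [pairLabel, cutLabel]

theorem pairLabel_of_ne {k : Fin 3} (hk : k ≠ k₀) (u v : Fin 3 → Fin 2)
    (X X' Y : Fin 2 × Fin 2) : pairLabel k₀ u v X Y k = pairLabel k₀ u v X' Y k := by
  simp [pairLabel, cutLabel, hk]

/-- The factor of a product operator that acts on the side of the cut opposite to party `k₀`,
restricted to the labels `pairLabel`; `v` and `v'` are the frames of the second register before and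
after. The value of `pairLabel` at these parties does not depend on its first argument, which is
set to `0`. -/
def restFactor (k₀ : Fin 3) (u v v' : Fin 3 → Fin 2)
    (A : Fin 3 → Matrix (Fin 2 × Fin 2) (Fin 2 × Fin 2) ℂ) :
    Matrix (Fin 2 × Fin 2) (Fin 2 × Fin 2) ℂ :=
  Matrix.of fun Y Y' =>
    ∏ k ∈ Finset.univ.erase k₀, A k (pairLabel k₀ u v' 0 Y k) (pairLabel k₀ u v 0 Y' k)

variable {u v v' : Fin 3 → Fin 2} (A : Fin 3 → Matrix (Fin 2 × Fin 2) (Fin 2 × Fin 2) ℂ)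

theorem tensorOp_pairLabel (X X' Y Y' : Fin 2 × Fin 2) :
    tensorOp A (pairLabel k₀ u v' X Y) (pairLabel k₀ u v X' Y') =
      A k₀ X X' * restFactor k₀ u v v' A Y Y' := by
  rw [tensorOp, Matrix.of_apply, ← Finset.mul_prod_erase _ _ (Finset.mem_univ k₀), pairLabel_self,
    pairLabel_self, restFactor, Matrix.of_apply]
  congr 1
  refine Finset.prod_congr rfl fun k hk => ?_
  have hk := Finset.ne_of_mem_erase hk
  rw [pairLabel_of_ne hk u v' X 0, pairLabel_of_ne hk u v X' 0]

/-- The amplitude matrix of a two-register vector with respect to the labels `pairLabel`. -/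
def amplitude (k₀ : Fin 3) (u v : Fin 3 → Fin 2) (a : (Fin 3 → Fin 2 × Fin 2) → ℂ) :
    Matrix (Fin 2 × Fin 2) (Fin 2 × Fin 2) ℂ :=
  Matrix.of fun X Y => a (pairLabel k₀ u v X Y)

theorem amplitude_tensorOp_mulVec {a : (Fin 3 → Fin 2 × Fin 2) → ℂ}
    (ha : ∀ l, (∀ X Y, l ≠ pairLabel k₀ u v X Y) → a l = 0) :
    amplitude k₀ u v' (tensorOp A *ᵥ a) =
      A k₀ * amplitude k₀ u v a * (restFactor k₀ u v v' A)ᵀ := by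
  ext X Y
  rw [amplitude, Matrix.of_apply, Matrix.mulVec, dotProduct,
    ← Fintype.sum_of_injective _ (pairLabel_injective (k₀ := k₀) u v) _ _ ?_ fun _ => rfl]
  · simp only [tensorOp_pairLabel, Matrix.mul_apply, Matrix.transpose_apply, Finset.sum_mul,
      amplitude, Matrix.of_apply]
    rw [Fintype.sum_prod_type, Finset.sum_comm]
    refine Finset.sum_congr rfl fun _ _ => Finset.sum_congr rfl fun _ _ => ?_
    ring
  · intro l hl
    rw [ha l fun X Y h => hl ⟨(X, Y), h.symm⟩, mul_zero]

/-- Restricting the completeness relation of product Kraus operators to the sixteen labels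
`pairLabel`. -/
theorem sum_frobSq_mul_frobSq_le {ι : Type} [Fintype ι]
    (A : ι → Fin 3 → Matrix (Fin 2 × Fin 2) (Fin 2 × Fin 2) ℂ)
    (hA : ∑ i, (tensorOp (A i))ᴴ * tensorOp (A i) = 1) :
    ∑ i, frobSq (A i k₀) * frobSq (restFactor k₀ u v v' (A i)) ≤ 4 ^ 2 := by
  have hcol : ∀ l, ∑ i, ∑ l', ‖tensorOp (A i) l' l‖ ^ 2 = 1 := by
    intro l
    have := congrFun (congrFun hA l) l
    simp only [Matrix.sum_apply, Matrix.mul_apply, Matrix.conjTranspose_apply, Complex.star_def,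
      Complex.conj_mul', Matrix.one_apply_eq] at this
    exact_mod_cast this
  have hprod : ∀ i, frobSq (A i k₀) * frobSq (restFactor k₀ u v v' (A i)) =
      ∑ q : (Fin 2 × Fin 2) × (Fin 2 × Fin 2), ∑ p : (Fin 2 × Fin 2) × (Fin 2 × Fin 2),
        ‖tensorOp (A i) (pairLabel k₀ u v' p.1 p.2) (pairLabel k₀ u v q.1 q.2)‖ ^ 2 := by
    intro i
    rw [← frobSq_kronecker, frobSq, Finset.sum_comm]
    simp only [tensorOp_pairLabel, Matrix.kroneckerMap_apply]
  simp only [hprod]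
  rw [Finset.sum_comm]
  calc _ ≤ ∑ q : (Fin 2 × Fin 2) × (Fin 2 × Fin 2), (1 : ℝ) := by
        refine Finset.sum_le_sum fun q _ => ?_
        rw [← hcol (pairLabel k₀ u v q.1 q.2)]
        refine Finset.sum_le_sum fun i _ => ?_
        rw [← Finset.sum_image (f := fun l => ‖tensorOp (A i) l (pairLabel k₀ u v q.1 q.2)‖ ^ 2)
          ((pairLabel_injective (k₀ := k₀) u v').injOn)]
        exact Finset.sum_le_univ_sum_of_nonneg fun _ => by positivity
    _ = 4 ^ 2 := by simp; norm_num

theorem amplitude_tensor (ψ φ : ThreeQubit) :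
    amplitude k₀ u v (tensor ψ φ).ofLp =
      Matrix.of (fun x y => ψ (cutLabel k₀ u x y)) ⊗ₖ
        Matrix.of (fun x y => φ (cutLabel k₀ v x y)) := rfl

end Cut

/-! ### CAT states through their dominant string -/

section Cat

/-- `ψ` is the sum of the basis vector labelled `d` with an amplitude of modulus `c` and of the
opposite basis vector, labelled `d + 1`, with an amplitude of modulus `s`. For `s < c` the string `d` carries the
larger amplitude. -/
def IsTwoTerm (c s : ℝ) (d : Fin 3 → Fin 2) (ψ : ThreeQubit) : Prop :=
  ∃ z w : ℂ, ‖z‖ = c ∧ ‖w‖ = s ∧ ∀ l, ψ l = if l = d then z else if l = d + 1 then w else 0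

/-- The string on which `catState α p i j` has amplitude `± cos α`. -/
def dominant (p i j : Fin 2) : Fin 3 → Fin 2 := ![p, i + p, j + p]

theorem dominant_inj {p i j p' i' j' : Fin 2} (h : dominant p i j = dominant p' i' j') :
    p = p' ∧ i = i' ∧ j = j' := by
  have h0 : p = p' := congrFun h 0
  have h1 : i + p = i' + p' := congrFun h 1
  have h2 : j + p = j' + p' := congrFun h 2
  subst h0
  exact ⟨rfl, add_right_cancel h1, add_right_cancel h2⟩

theorem isTwoTerm_catState {α : ℝ} (hc : 0 ≤ Real.cos α) (hs : 0 ≤ Real.sin α) {z : ℂ}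
    (hz : ‖z‖ = 1) (p i j : Fin 2) :
    IsTwoTerm (Real.cos α) (Real.sin α) (dominant p i j) (z • catState α p i j) := by
  have hflip : ∀ i : Fin 2, 1 - i = i + 1 := by decide
  have hkey : ∀ l : Fin 3 → Fin 2, catState α p i j l =
      if l = dominant p i j then (-1) ^ (p : ℕ) * (Real.cos α : ℂ) else
        if l = dominant p i j + 1 then (Real.sin α : ℂ) else 0 := by
    intro l
    have hne : (![0, i, j] : Fin 3 → Fin 2) ≠ ![1, i + 1, j + 1] := fun h =>
      absurd (congrFun h 0) (by simp)
    have hadd : ∀ a b c : Fin 2, (![a, b, c] + 1 : Fin 3 → Fin 2) = ![a + 1, b + 1, c + 1] :=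
      fun a b c => by ext k; fin_cases k <;> rfl
    have hcancel : ∀ a : Fin 2, a + 1 + 1 = a := by decide
    fin_cases p
    · by_cases h1 : l = ![0, i, j]
      · subst h1; simp [catState, ket, dominant, hflip, hne]
      · simp [catState, ket, dominant, hflip, hadd, h1]
    · by_cases h1 : l = ![0, i, j]
      · subst h1; simp [catState, ket, dominant, hflip, hadd, hcancel, hne]
      · simp only [catState, ket, dominant, hflip, hadd]
        by_cases h2 : l = ![1, i + 1, j + 1] <;> simp [hcancel, h1, h2]
  refine ⟨z * ((-1) ^ (p : ℕ) * (Real.cos α : ℂ)), z * (Real.sin α : ℂ), ?_, ?_, fun l => ?_⟩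
  · rw [norm_mul, norm_mul, hz, Complex.norm_real, Real.norm_of_nonneg hc]; simp
  · rw [norm_mul, hz, Complex.norm_real, Real.norm_of_nonneg hs, one_mul]
  · rw [PiLp.smul_apply, hkey, smul_eq_mul, mul_ite, mul_ite, mul_zero]

variable {c s : ℝ} {k₀ : Fin 3} {u : Fin 3 → Fin 2} {x y : Fin 2}

theorem twoTerm_cutLabel {z w : ℂ} {ψ : ThreeQubit}
    (h : ∀ l, ψ l = if l = cutLabel k₀ u x y then z else
      if l = cutLabel k₀ u x y + 1 then w else 0) :
    Matrix.of (fun x y => ψ (cutLabel k₀ u x y)) = twoTerm x y z w := by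
  ext i j
  simp only [Matrix.of_apply, h, twoTerm, ← cutLabel_add_one, cutLabel_inj]

theorem IsTwoTerm.eq_zero {ψ : ThreeQubit} (h : IsTwoTerm c s (cutLabel k₀ u x y) ψ)
    {l : Fin 3 → Fin 2} (hl : ∀ x y, l ≠ cutLabel k₀ u x y) : ψ l = 0 := by
  obtain ⟨z, w, -, -, h⟩ := h
  rw [h, if_neg (hl _ _), ← cutLabel_add_one, if_neg (hl _ _)]

theorem tensor_eq_zero {ψ φ : ThreeQubit} {v : Fin 3 → Fin 2} {x' y' : Fin 2}
    (hψ : IsTwoTerm c s (cutLabel k₀ u x y) ψ) (hφ : IsTwoTerm c s (cutLabel k₀ v x' y') φ)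
    (l : Fin 3 → Fin 2 × Fin 2) (hl : ∀ X Y, l ≠ pairLabel k₀ u v X Y) :
    (tensor ψ φ).ofLp l = 0 := by
  change ψ (fun k => (l k).1) * φ (fun k => (l k).2) = 0
  by_contra hne
  obtain ⟨h1, h2⟩ := mul_ne_zero_iff.1 hne
  obtain ⟨x₁, y₁, h1⟩ : ∃ x y, (fun k => (l k).1) = cutLabel k₀ u x y := by
    by_contra! hc
    exact h1 (hψ.eq_zero hc)
  obtain ⟨x₂, y₂, h2⟩ : ∃ x y, (fun k => (l k).2) = cutLabel k₀ v x y := by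
    by_contra! hc
    exact h2 (hφ.eq_zero hc)
  exact hl (x₁, x₂) (y₁, y₂) (funext fun k => Prod.ext (congrFun h1 k) (congrFun h2 k))

end Cat

/-! ### Gain and defect as functions of the output state -/

section Output

open scoped Kronecker ComplexConjugate

variable {n : Type} [Fintype n] {ι : Type} [Fintype ι]

/-- `frobSq` as a linear function of the density matrix. -/
def massOf (σ : n × n → n × n → ℂ) : ℝ := ∑ a, (σ a a).re

/-- `defect N` as a linear function of the density matrix. -/
noncomputable def defectOf (N : Matrix n n ℂ) (σ : n × n → n × n → ℂ) : ℝ :=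
  ∑ a : n × n, ∑ b : n × n,
    (N b.1 b.2 * conj (N b.1 b.2) * σ a a - N b.1 b.2 * conj (N a.1 a.2) * σ a b
      - N a.1 a.2 * conj (N b.1 b.2) * σ b a + N a.1 a.2 * conj (N a.1 a.2) * σ b b).re

theorem massOf_sum {C : ι → Matrix n n ℂ} {σ : n × n → n × n → ℂ}
    (hσ : ∀ a b, σ a b = ∑ i, C i a.1 a.2 * conj (C i b.1 b.2)) :
    massOf σ = ∑ i, frobSq (C i) := by
  have : ∀ i, frobSq (C i) = ∑ a : n × n, (C i a.1 a.2 * conj (C i a.1 a.2)).re := fun i => by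
    rw [frobSq, Fintype.sum_prod_type]
    simp only [Complex.mul_conj']
    norm_cast
  simp only [massOf, hσ, Complex.re_sum, this]
  exact Finset.sum_comm

theorem defectOf_sum (N : Matrix n n ℂ) {C : ι → Matrix n n ℂ} {σ : n × n → n × n → ℂ}
    (hσ : ∀ a b, σ a b = ∑ i, C i a.1 a.2 * conj (C i b.1 b.2)) :
    defectOf N σ = ∑ i, defect N (C i) := by
  have : ∀ i, defect N (C i) = ∑ a : n × n, ∑ b : n × n,
      ((N b.1 b.2 * C i a.1 a.2 - N a.1 a.2 * C i b.1 b.2) *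
        conj (N b.1 b.2 * C i a.1 a.2 - N a.1 a.2 * C i b.1 b.2)).re := fun i => by
    simp only [Complex.mul_conj', defect]
    norm_cast
  simp only [defectOf, this]
  rw [Finset.sum_comm (γ := ι)]
  refine Finset.sum_congr rfl fun a _ => ?_
  rw [Finset.sum_comm (γ := ι)]
  refine Finset.sum_congr rfl fun b _ => ?_
  rw [← Complex.re_sum]
  simp only [hσ, Finset.mul_sum, ← Finset.sum_sub_distrib, ← Finset.sum_add_distrib]
  congr 1
  refine Finset.sum_congr rfl fun i _ => ?_
  simp only [map_sub, map_mul]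
  ring

theorem continuous_massOf : Continuous (massOf : (n × n → n × n → ℂ) → ℝ) := by
  unfold massOf; fun_prop

theorem continuous_defectOf (N : Matrix n n ℂ) : Continuous (defectOf N) := by
  unfold defectOf; fun_prop

theorem defect_self (N : Matrix n n ℂ) : defect N N = 0 := by
  simp [defect, mul_comm]

theorem kraus_proj_apply {κ : Type} [Fintype κ] (T : ι → Matrix κ κ ℂ) (a : EuclideanSpace ℂ κ)
    (l l' : κ) :
    (∑ i, T i * proj a * (T i)ᴴ) l l' = ∑ i, (T i *ᵥ a.ofLp) l * conj ((T i *ᵥ a.ofLp) l') := by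
  rw [Matrix.sum_apply]
  refine Finset.sum_congr rfl fun i _ => ?_
  rw [proj, Matrix.mul_vecMulVec, Matrix.vecMulVec_mul, ← Matrix.star_mulVec]
  rfl

end Output

/-! ### Impossibility of cloning -/

section Cloning

open scoped Kronecker

/-- The restriction of an operator on two registers to the labels `pairLabel`. -/
def pairBlock (k₀ : Fin 3) (u v : Fin 3 → Fin 2)
    (ρ : Matrix (Fin 3 → Fin 2 × Fin 2) (Fin 3 → Fin 2 × Fin 2) ℂ) :
    (Fin 2 × Fin 2) × (Fin 2 × Fin 2) → (Fin 2 × Fin 2) × (Fin 2 × Fin 2) → ℂ :=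
  fun a b => ρ (pairLabel k₀ u v a.1 a.2) (pairLabel k₀ u v b.1 b.2)

theorem continuous_pairBlock (k₀ : Fin 3) (u v : Fin 3 → Fin 2) :
    Continuous (pairBlock k₀ u v) := by
  unfold pairBlock; fun_prop

/-- If an LOCC operation clones two two-term states with a two-term blank copy, all with the same
moduli of amplitudes, then the two states have the same dominant string. -/
theorem dominant_eq_of_isLOCC {c s : ℝ} (hs : 0 < s) (hcs : s < c) (h1 : c ^ 2 + s ^ 2 = 1)
    {Λ : Matrix (Fin 3 → Fin 2 × Fin 2) (Fin 3 → Fin 2 × Fin 2) ℂ →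
      Matrix (Fin 3 → Fin 2 × Fin 2) (Fin 3 → Fin 2 × Fin 2) ℂ}
    (hΛ : IsLOCC (H := fun _ => Fin 2 × Fin 2) (K := fun _ => Fin 2 × Fin 2) Λ)
    {d d' e : Fin 3 → Fin 2} {ψ φ b : ThreeQubit}
    (hψ : IsTwoTerm c s d ψ) (hφ : IsTwoTerm c s d' φ) (hb : IsTwoTerm c s e b)
    (hΛψ : Λ (proj (tensor ψ b)) = proj (tensor ψ ψ))
    (hΛφ : Λ (proj (tensor φ b)) = proj (tensor φ φ)) : d = d' := by
  obtain ⟨k₀, y, hd'⟩ := exists_cutLabel_eq d d'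
  have hd : d = cutLabel k₀ d (d k₀) 0 := (cutLabel_self d).symm
  have he : e = cutLabel k₀ e (e k₀) 0 := (cutLabel_self e).symm
  have hψ' := hψ; have hφ' := hφ; have hb' := hb
  rw [hd] at hψ'
  rw [hd'] at hφ'
  rw [he] at hb'
  obtain ⟨z, w, hz, hw, hψa⟩ := id hψ'
  obtain ⟨z', w', hz', hw', hφa⟩ := id hφ'
  obtain ⟨zb, wb, hzb, hwb, hba⟩ := id hb'
  have hM : amplitude k₀ d e (tensor ψ b).ofLp =
      twoTerm (d k₀) 0 z w ⊗ₖ twoTerm (e k₀) 0 zb wb := by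
    rw [amplitude_tensor, twoTerm_cutLabel hψa, twoTerm_cutLabel hba]
  have hM' : amplitude k₀ d e (tensor φ b).ofLp =
      twoTerm (d' k₀) y z' w' ⊗ₖ twoTerm (e k₀) 0 zb wb := by
    rw [amplitude_tensor, twoTerm_cutLabel hφa, twoTerm_cutLabel hba]
  have hN : amplitude k₀ d d (tensor ψ ψ).ofLp =
      twoTerm (d k₀) 0 z w ⊗ₖ twoTerm (d k₀) 0 z w := by
    rw [amplitude_tensor, twoTerm_cutLabel hψa]
  have hN' : amplitude k₀ d d (tensor φ φ).ofLp =
      twoTerm (d' k₀) y z' w' ⊗ₖ twoTerm (d' k₀) y z' w' := by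
    rw [amplitude_tensor, twoTerm_cutLabel hφa]
  have hN1 : frobSq (twoTerm (d k₀) 0 z w ⊗ₖ twoTerm (d k₀) 0 z w) = 1 := by
    rw [frobSq_kronecker, frobSq_twoTerm hz hw, h1, one_mul]
  have hN1' : frobSq (twoTerm (d' k₀) y z' w' ⊗ₖ twoTerm (d' k₀) y z' w') = 1 := by
    rw [frobSq_kronecker, frobSq_twoTerm hz' hw', h1, one_mul]
  set M := twoTerm (d k₀) 0 z w ⊗ₖ twoTerm (e k₀) 0 zb wb
  set M' := twoTerm (d' k₀) y z' w' ⊗ₖ twoTerm (e k₀) 0 zb wb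
  set N := twoTerm (d k₀) 0 z w ⊗ₖ twoTerm (d k₀) 0 z w
  set N' := twoTerm (d' k₀) y z' w' ⊗ₖ twoTerm (d' k₀) y z' w'
  obtain ⟨Φ, hΦ, hlim⟩ := hΛ
  have hblock : ∀ a : TwoRegisters, ∀ p q, pairBlock k₀ d d (proj a) p q = ∑ _i : Unit,
      amplitude k₀ d d a.ofLp p.1 p.2 * (starRingEnd ℂ) (amplitude k₀ d d a.ofLp q.1 q.2) :=
    fun a p q => by rw [Fintype.sum_unique]; rfl
  have hlimψ : Tendsto (fun k => pairBlock k₀ d d (Φ k (proj (tensor ψ b)))) atTop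
      (𝓝 (pairBlock k₀ d d (proj (tensor ψ ψ)))) :=
    hΛψ ▸ ((continuous_pairBlock k₀ d d).tendsto _).comp (hlim _)
  have hlimφ : Tendsto (fun k => pairBlock k₀ d d (Φ k (proj (tensor φ b)))) atTop
      (𝓝 (pairBlock k₀ d d (proj (tensor φ φ)))) :=
    hΛφ ▸ ((continuous_pairBlock k₀ d d).tendsto _).comp (hlim _)
  have hgain := (continuous_massOf.tendsto _).comp hlimψ
  have hdef := ((continuous_defectOf N).tendsto _).comp hlimψ
  have hdef' := ((continuous_defectOf N').tendsto _).comp hlimφ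
  rw [massOf_sum (hblock _), Fintype.sum_unique, hN, hN1] at hgain
  rw [defectOf_sum N (hblock _), Fintype.sum_unique, hN, defect_self] at hdef
  rw [defectOf_sum N' (hblock _), Fintype.sum_unique, hN', defect_self] at hdef'
  have hsum := hdef.add hdef'
  rw [add_zero] at hsum
  obtain ⟨A, B, hA, hB, hge, hdA, hdB⟩ := exists_product_operator (s := 4) (by norm_num)
    (M := M) (N := N) (M' := M') (N' := N') (by
      intro δ hδ
      obtain ⟨k, hk1, hk2⟩ := ((hgain.eventually (lt_mem_nhds (sub_lt_self 1 hδ))).and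
        (hsum.eventually (gt_mem_nhds hδ))).exists
      obtain ⟨ι, hι, A, hkraus, hcompl⟩ := (hΦ k).exists_kraus
      have hout : ∀ {χ : ThreeQubit}, (∀ l, (∀ X Y, l ≠ pairLabel k₀ d e X Y) →
          (tensor χ b).ofLp l = 0) → ∀ p q,
          pairBlock k₀ d d (Φ k (proj (tensor χ b))) p q = ∑ i,
            (A i k₀ * amplitude k₀ d e (tensor χ b).ofLp * (restFactor k₀ d e d (A i))ᵀ) p.1 p.2 *
            (starRingEnd ℂ) ((A i k₀ * amplitude k₀ d e (tensor χ b).ofLp *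
              (restFactor k₀ d e d (A i))ᵀ) q.1 q.2) := by
        intro χ hχ p q
        rw [pairBlock, hkraus, kraus_proj_apply]
        simp only [← amplitude_tensorOp_mulVec _ hχ]
        rfl
      have houtψ := hout (tensor_eq_zero hψ' hb')
      have houtφ := hout (tensor_eq_zero hφ' hb')
      rw [hM] at houtψ
      rw [hM'] at houtφ
      refine ⟨ι, hι, fun i => A i k₀, fun i => restFactor k₀ d e d (A i),
        sum_frobSq_mul_frobSq_le A hcompl, ?_, ?_⟩
      · rw [← massOf_sum houtψ]
        exact hk1.le
      · rw [Finset.sum_add_distrib, ← defectOf_sum N houtψ, ← defectOf_sum N' houtφ]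
        exact hk2.le)
  have hN0 : N ≠ 0 := fun h0 => by simp [h0, frobSq] at hN1
  have hN0' : N' ≠ 0 := fun h0 => by simp [h0, frobSq] at hN1'
  obtain ⟨lam, hlam⟩ := exists_smul_of_defect_eq_zero hN0 hdA
  obtain ⟨mu, hmu⟩ := exists_smul_of_defect_eq_zero hN0' hdB
  obtain ⟨hx, hy⟩ :=
    eq_of_product_operator_clones hs hcs h1 hz hw hz' hw' hzb hwb hA hB hge hlam hmu
  rw [hd', ← hx, ← hy]
  exact hd

theorem catState_ne_zero {α : ℝ} (hc : 0 < Real.cos α) (hs : 0 ≤ Real.sin α) (p i j : Fin 2) :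
    catState α p i j ≠ 0 := by
  intro h0
  obtain ⟨z, w, hz, -, h⟩ := isTwoTerm_catState hc.le hs (z := 1) (by simp) p i j
  have := h (dominant p i j)
  rw [h0, if_pos rfl] at this
  rw [← this] at hz
  simp at hz
  exact hc.ne hz

end Cloning

end CatCloning

theorem theorem1 (α : ℝ) (hα : 0 < α) (hα' : α < Real.pi / 4)
    (S : Set CatCloning.ThreeQubit)
    (hcat : ∀ ψ ∈ S, CatCloning.IsCAT α ψ)
    (horth : ∀ ψ ∈ S, ∀ φ ∈ S, ψ ≠ φ → inner ℂ ψ φ = 0)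
    (hS : S.Nontrivial)
    (b : CatCloning.ThreeQubit) (hb : CatCloning.IsCAT α b) :
    ¬ CatCloning.LOCCClonable S b := by
  rintro ⟨Λ, hΛ, hclone⟩
  have hπ := Real.pi_pos
  have hs : 0 < Real.sin α := Real.sin_pos_of_pos_of_lt_pi hα (by linarith)
  have hcs : Real.sin α < Real.cos α := by
    rw [← Real.sin_pi_div_two_sub]
    exact Real.sin_lt_sin_of_lt_of_le_pi_div_two (by linarith) (by linarith) (by linarith)
  have hc := hs.trans hcs
  obtain ⟨ψ, hψ, φ, hφ, hne⟩ := hS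
  obtain ⟨z, p, i, j, hz, rfl⟩ := hcat ψ hψ
  obtain ⟨z', p', i', j', hz', rfl⟩ := hcat φ hφ
  obtain ⟨zb, pb, ib, jb, hzb, rfl⟩ := hb
  obtain ⟨rfl, rfl, rfl⟩ := CatCloning.dominant_inj <|
    CatCloning.dominant_eq_of_isLOCC hs hcs (Real.cos_sq_add_sin_sq α) hΛ
      (CatCloning.isTwoTerm_catState hc.le hs.le hz p i j)
      (CatCloning.isTwoTerm_catState hc.le hs.le hz' p' i' j')
      (CatCloning.isTwoTerm_catState hc.le hs.le hzb pb ib jb) (hclone _ hψ) (hclone _ hφ)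
  have h0 := horth _ hψ _ hφ hne
  rw [inner_smul_left, inner_smul_right, mul_eq_zero, mul_eq_zero, inner_self_eq_zero] at h0
  rcases h0 with h0 | h0 | h0
  · rw [map_eq_zero] at h0; simp [h0] at hz
  · simp [h0] at hz'
  · exact CatCloning.catState_ne_zero hc hs.le p i j h0
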